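/- Let $\mathcal{X}$ and $\mathcal{Y}$ be complex Hilbert spaces, possibly infinite-dimensional, with $\dim\mathcal{Y}\ge 2$. Let $D(\mathcal{X})$ be the set of density operators on $\mathcal{X}$ (positive trace-class operators of trace one), and let $\mathcal{F}(\mathcal{X})\subseteq D(\mathcal{X})$ be a non-empty convex set that is closed in the trace norm $\|T\|_1=\operatorname{Tr}\sqrt{T^\dagger T}$ (the free states). A subchannel is a completely positive trace-nonincreasing linear map from the trace-class operators on $\mathcal{X}$ to those on $\mathcal{Y}$; a channel is a completely positive trace-preserving one. For subchannels $\Psi_0,\Psi_1$ whose sum $\Psi_0+\Psi_1$ is a channel, a two-outcome POVM $\{M_0,M_1\}$ on $\mathcal{Y}$ (bounded operators $M_i\ge 0$ with $M_0+M_1=I$) and a state $\eta\in D(\mathcal{X})$, let $$p_{\mathrm{succ}}(\{\Psi_i\},\{M_i\},\eta)=\sum_{i}\operatorname{Tr}\big(M_i\Psi_i(\eta)\big).$$ The maximum of $p_{\mathrm{succ}}(\{\Psi_i\},\{M_i\},\eta)$ over all such POVMs is always attained. Let $\rho\in D(\mathcal{X})$. Then the following are equivalent: (i) $\rho\notin\mathcal{F}(\mathcal{X})$;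 (ii) there exist subchannels $\Psi_0,\Psi_1$ from $\mathcal{X}$ to $\mathcal{Y}$, whose sum is a channel, such that $$\frac{\max_{\{M_i\}}p_{\mathrm{succ}}(\{\Psi_i\},\{M_i\},\rho)}{\sup_{\sigma\in\mathcal{F}(\mathcal{X})}\max_{\{M_i\}}p_{\mathrm{succ}}(\{\Psi_i\},\{M_i\},\sigma)}>1;$$ (iii) there exist channels $\Lambda_0,\Lambda_1$ from $\mathcal{X}$ to $\mathcal{Y}$ such that the inequality in (ii) holds for $\Psi_i=\tfrac12\Lambda_i$. -/

import Mathlib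

open scoped ComplexOrder InnerProductSpace

noncomputable section

namespace QResource

universe u v

section TraceClassOperators

variable (X : Type u) [NormedAddCommGroup X] [InnerProductSpace ℂ X] [CompleteSpace X]

/-- The underlying set of a (chosen) orthonormal Hilbert basis of `X`. -/
def basisSet : Set X := Classical.choose (exists_hilbertBasis ℂ X)

/-- A (chosen) orthonormal Hilbert basis of `X`, used to evaluate traces. The trace norm, the trace
class and the trace of a trace-class operator do not depend on this choice. -/
def stdBasis : HilbertBasis (basisSet X) ℂ X :=
  Classical.choose (Classical.choose_spec (exists_hilbertBasis ℂ X))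

variable {X}

/-- The trace `Tr A = ∑ i, ⟨e i, A (e i)⟩`. For trace-class `A` the series converges absolutely. -/
def opTrace (A : X →L[ℂ] X) : ℂ := ∑' i, ⟪stdBasis X i, A (stdBasis X i)⟫_ℂ

/-- `T` is of trace class: `Tr |T| < ∞`, where `|T| = √(T⋆ T)`. The summands are nonnegative. -/
def IsTraceClass (T : X →L[ℂ] X) : Prop :=
  Summable fun i => (⟪stdBasis X i, CFC.abs T (stdBasis X i)⟫_ℂ).re

/-- The trace norm `‖T‖₁ = Tr |T|`. -/
def traceNorm (T : X →L[ℂ] X) : ℝ :=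
  ∑' i, (⟪stdBasis X i, CFC.abs T (stdBasis X i)⟫_ℂ).re

/-! Auxiliary facts: the trace-class operators form a linear space normed by `traceNorm`. -/

/-- Squared Hilbert–Schmidt norm, possibly infinite. -/
def hsNormSq (B : X →L[ℂ] X) : ENNReal := ∑' i, ‖B (stdBasis X i)‖ₑ ^ 2

/-- The trace norm as an extended nonnegative real. -/
def eTraceNorm (T : X →L[ℂ] X) : ENNReal :=
  ∑' i, ENNReal.ofReal (⟪stdBasis X i, CFC.abs T (stdBasis X i)⟫_ℂ).re

theorem parseval (x : X) : ∑' i, ‖⟪stdBasis X i, x⟫_ℂ‖ₑ ^ 2 = ‖x‖ₑ ^ 2 := by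
  have h := Complex.hasSum_re ((stdBasis X).hasSum_inner_mul_inner x x)
  have e1 : ∀ i, (⟪x, stdBasis X i⟫_ℂ * ⟪stdBasis X i, x⟫_ℂ).re = ‖⟪stdBasis X i, x⟫_ℂ‖ ^ 2 := by
    intro i
    rw [← inner_conj_symm, ← Complex.normSq_eq_conj_mul_self, Complex.ofReal_re,
      Complex.normSq_eq_norm_sq]
  have e2 : (⟪x, x⟫_ℂ).re = ‖x‖ ^ 2 := by
    rw [inner_self_eq_norm_sq_to_K]; norm_cast
  rw [e2] at h
  simp only [e1] at h
  have h2 := ENNReal.ofReal_tsum_of_nonneg (fun i => by positivity) h.summable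
  rw [h.tsum_eq] at h2
  simp only [ENNReal.ofReal_pow (norm_nonneg _), ofReal_norm] at h2
  exact h2.symm

theorem hsNormSq_adjoint (B : X →L[ℂ] X) : hsNormSq (star B) = hsNormSq B := by
  unfold hsNormSq
  simp only [← parseval (star B _), ← parseval (B _)]
  rw [ENNReal.tsum_comm]
  refine tsum_congr fun i => tsum_congr fun j => ?_
  rw [ContinuousLinearMap.star_eq_adjoint, ContinuousLinearMap.adjoint_inner_right,
    ← ofReal_norm, ← ofReal_norm, norm_inner_symm]

theorem hsNormSq_contraction_comp {C : X →L[ℂ] X} (hC : ‖C‖ ≤ 1) (B : X →L[ℂ] X) :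
    hsNormSq (C * B) ≤ hsNormSq B := by
  refine ENNReal.tsum_le_tsum fun i => ?_
  gcongr
  rw [mul_apply_eq_comp, ← ofReal_norm, ← ofReal_norm]
  apply ENNReal.ofReal_le_ofReal
  simpa using C.le_of_opNorm_le hC (B (stdBasis X i))

theorem hsNormSq_comp_contraction {C : X →L[ℂ] X} (hC : ‖C‖ ≤ 1) (B : X →L[ℂ] X) :
    hsNormSq (B * C) ≤ hsNormSq B := by
  rw [← hsNormSq_adjoint (B * C), ← hsNormSq_adjoint B, star_mul]
  exact hsNormSq_contraction_comp (by simpa using hC) _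

theorem inner_abs_eq (T : X →L[ℂ] X) (x : X) :
    ⟪x, CFC.abs T x⟫_ℂ = ((‖CFC.sqrt (CFC.abs T) x‖ ^ 2 : ℝ) : ℂ) := by
  have h : CFC.sqrt (CFC.abs T) * CFC.sqrt (CFC.abs T) = CFC.abs T :=
    CFC.sqrt_mul_sqrt_self _ (CFC.abs_nonneg T)
  have hs : star (CFC.sqrt (CFC.abs T)) = CFC.sqrt (CFC.abs T) :=
    (IsSelfAdjoint.of_nonneg (CFC.sqrt_nonneg (CFC.abs T))).star_eq
  conv_lhs => rw [← h]
  rw [mul_apply_eq_comp, ← ContinuousLinearMap.adjoint_inner_left,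
    ← ContinuousLinearMap.star_eq_adjoint, hs, inner_self_eq_norm_sq_to_K]
  norm_cast

theorem inner_abs_nonneg (T : X →L[ℂ] X) (x : X) : 0 ≤ (⟪x, CFC.abs T x⟫_ℂ).re := by
  rw [inner_abs_eq, Complex.ofReal_re]; positivity

theorem eTraceNorm_eq_hsNormSq (T : X →L[ℂ] X) :
    eTraceNorm T = hsNormSq (CFC.sqrt (CFC.abs T)) := by
  refine tsum_congr fun i => ?_
  rw [inner_abs_eq, Complex.ofReal_re, ENNReal.ofReal_pow (norm_nonneg _), ofReal_norm]

theorem isTraceClass_iff (T : X →L[ℂ] X) : IsTraceClass T ↔ eTraceNorm T ≠ ⊤ := by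
  constructor
  · intro h
    rw [eTraceNorm, ← ENNReal.ofReal_tsum_of_nonneg (fun i => inner_abs_nonneg T _) h]
    exact ENNReal.ofReal_ne_top
  · intro h
    refine (ENNReal.summable_toReal h).congr fun i => ?_
    rw [ENNReal.toReal_ofReal (inner_abs_nonneg T _)]

theorem traceNorm_eq_toReal (T : X →L[ℂ] X) : traceNorm T = (eTraceNorm T).toReal := by
  rw [eTraceNorm, ENNReal.tsum_toReal_eq (fun _ => ENNReal.ofReal_ne_top)]
  exact tsum_congr fun i => (ENNReal.toReal_ofReal (inner_abs_nonneg T _)).symm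

theorem norm_abs_apply (T : X →L[ℂ] X) (x : X) : ‖CFC.abs T x‖ = ‖T x‖ := by
  have hs : star (CFC.abs T) = CFC.abs T := (IsSelfAdjoint.of_nonneg (CFC.abs_nonneg T)).star_eq
  have h : ⟪CFC.abs T x, CFC.abs T x⟫_ℂ = ⟪T x, T x⟫_ℂ := by
    rw [← ContinuousLinearMap.adjoint_inner_right, ← ContinuousLinearMap.star_eq_adjoint, hs,
      ← mul_apply_eq_comp, CFC.abs_mul_abs, mul_apply_eq_comp,
      ContinuousLinearMap.star_eq_adjoint, ContinuousLinearMap.adjoint_inner_right]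
  rw [inner_self_eq_norm_sq_to_K, inner_self_eq_norm_sq_to_K] at h
  have h' : ‖CFC.abs T x‖ ^ 2 = ‖T x‖ ^ 2 := by exact_mod_cast h
  exact (sq_eq_sq₀ (norm_nonneg _) (norm_nonneg _)).1 h'

/-- Polar decomposition. -/
theorem exists_polar (T : X →L[ℂ] X) :
    ∃ V : X →L[ℂ] X, ‖V‖ ≤ 1 ∧ T = V * CFC.abs T ∧ CFC.abs T = star V * T := by
  set A := CFC.abs T with hA
  have hs : star A = A := (IsSelfAdjoint.of_nonneg (CFC.abs_nonneg T)).star_eq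
  let K : Submodule ℂ X := (LinearMap.range (A : X →ₗ[ℂ] X)).topologicalClosure
  have hmem : ∀ x, A x ∈ K := fun x => Submodule.le_topologicalClosure _ ⟨x, rfl⟩
  let e : X →ₗ[ℂ] K := (A : X →ₗ[ℂ] X).codRestrict K hmem
  have hd : DenseRange e := by
    intro z
    rw [closure_subtype]
    have h1 : ((↑) : K → X) '' Set.range e = Set.range A := by
      ext y; constructor
      · rintro ⟨_, ⟨x, rfl⟩, rfl⟩; exact ⟨x, rfl⟩
      · rintro ⟨x, rfl⟩; exact ⟨e x, ⟨x, rfl⟩, rfl⟩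
    rw [h1]
    exact z.2
  have hn : ∀ x, ‖(T : X →ₗ[ℂ] X) x‖ ≤ 1 * ‖e x‖ := by
    intro x
    rw [one_mul]
    exact (norm_abs_apply T x).ge
  have : CompleteSpace K := (Submodule.isClosed_topologicalClosure _).completeSpace_coe
  let V₀ : K →L[ℂ] X := (T : X →ₗ[ℂ] X).extendOfNorm e
  have hV₀ : ∀ x, V₀ (e x) = T x := LinearMap.extendOfNorm_eq hd ⟨1, hn⟩
  have hV₀n : ∀ z, ‖V₀ z‖ ≤ 1 * ‖z‖ := LinearMap.norm_extendOfNorm_apply_le hd 1 hn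
  refine ⟨V₀ ∘L K.orthogonalProjectionOnto, ?_, ?_, ?_⟩
  · refine ContinuousLinearMap.opNorm_le_bound _ zero_le_one fun x => ?_
    refine (hV₀n _).trans ?_
    gcongr
    exact K.norm_orthogonalProjectionOnto_apply_le x
  · ext x
    have : K.orthogonalProjectionOnto (A x) = e x :=
      Submodule.orthogonalProjectionOnto_mem_subspace_eq_self (e x)
    simp [this, hV₀]
  · have key : ∀ (x : X) (z : K), ⟪A x, (z : X)⟫_ℂ = ⟪T x, V₀ z⟫_ℂ := by
      intro x z
      refine hd.induction_on z (isClosed_eq (by fun_prop) (by fun_prop)) fun w => ?_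
      rw [hV₀]
      change ⟪A x, A w⟫_ℂ = _
      rw [← ContinuousLinearMap.adjoint_inner_right, ← ContinuousLinearMap.star_eq_adjoint, hs,
        ← mul_apply_eq_comp, CFC.abs_mul_abs, mul_apply_eq_comp,
        ContinuousLinearMap.star_eq_adjoint, ContinuousLinearMap.adjoint_inner_right]
    ext x
    refine ext_inner_right ℂ fun y => ?_
    rw [mul_apply_eq_comp, ContinuousLinearMap.star_eq_adjoint,
      ContinuousLinearMap.adjoint_inner_left, ContinuousLinearMap.comp_apply, ← key]
    have h0 := K.starProjection_inner_eq_zero y (A x) (hmem x)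
    rw [inner_eq_zero_symm, inner_sub_right, sub_eq_zero] at h0
    exact h0

theorem tsum_inner_le_eTraceNorm {U : X →L[ℂ] X} (hU : ‖U‖ ≤ 1) (T : X →L[ℂ] X) :
    ∑' i, ‖⟪stdBasis X i, (U * T) (stdBasis X i)⟫_ℂ‖ₑ ≤ eTraceNorm T := by
  obtain ⟨V, hV, hT, -⟩ := exists_polar T
  set R := CFC.sqrt (CFC.abs T) with hR
  have hRR : R * R = CFC.abs T := CFC.sqrt_mul_sqrt_self _ (CFC.abs_nonneg T)
  have hs : star R = R := (IsSelfAdjoint.of_nonneg (CFC.sqrt_nonneg (CFC.abs T))).star_eq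
  set W := star (U * V) with hW
  have hWn : ‖W‖ ≤ 1 := by
    rw [hW, norm_star]
    exact (norm_mul_le _ _).trans (mul_le_one₀ hU (norm_nonneg _) hV)
  have h1 : ∀ x : X, ⟪x, (U * T) x⟫_ℂ = ⟪(R * W) x, R x⟫_ℂ := by
    intro x
    have : U * T = star (R * W) * R := by
      rw [star_mul, hs, hW, star_star, mul_assoc, hRR, mul_assoc, ← hT]
    rw [this, mul_apply_eq_comp, ContinuousLinearMap.star_eq_adjoint,
      ContinuousLinearMap.adjoint_inner_right]
  have h2 : ∀ x : X, ‖⟪x, (U * T) x⟫_ℂ‖ₑ ≤ 2⁻¹ * ‖(R * W) x‖ₑ ^ 2 + 2⁻¹ * ‖R x‖ₑ ^ 2 := by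
    intro x
    rw [h1, ← ofReal_norm, ← ofReal_norm, ← ofReal_norm, ← ENNReal.ofReal_pow (norm_nonneg _),
      ← ENNReal.ofReal_pow (norm_nonneg _),
      show (2⁻¹ : ENNReal) = ENNReal.ofReal 2⁻¹ by
        rw [ENNReal.ofReal_inv_of_pos two_pos]; norm_num,
      ← ENNReal.ofReal_mul (by norm_num), ← ENNReal.ofReal_mul (by norm_num),
      ← ENNReal.ofReal_add (by positivity) (by positivity)]
    apply ENNReal.ofReal_le_ofReal
    have := norm_inner_le_norm (𝕜 := ℂ) ((R * W) x) (R x)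
    nlinarith [sq_nonneg (‖(R * W) x‖ - ‖R x‖)]
  calc ∑' i, ‖⟪stdBasis X i, (U * T) (stdBasis X i)⟫_ℂ‖ₑ
      ≤ ∑' i, (2⁻¹ * ‖(R * W) (stdBasis X i)‖ₑ ^ 2 + 2⁻¹ * ‖R (stdBasis X i)‖ₑ ^ 2) :=
        ENNReal.tsum_le_tsum fun i => h2 _
    _ = 2⁻¹ * hsNormSq (R * W) + 2⁻¹ * hsNormSq R := by
        rw [ENNReal.tsum_add, ENNReal.tsum_mul_left, ENNReal.tsum_mul_left]; rfl
    _ ≤ 2⁻¹ * hsNormSq R + 2⁻¹ * hsNormSq R := by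
        gcongr
        exact hsNormSq_comp_contraction hWn R
    _ = eTraceNorm T := by
        rw [← add_mul, ENNReal.inv_two_add_inv_two, one_mul, eTraceNorm_eq_hsNormSq]

theorem eTraceNorm_add_le (S T : X →L[ℂ] X) :
    eTraceNorm (S + T) ≤ eTraceNorm S + eTraceNorm T := by
  obtain ⟨V, hV, -, hA⟩ := exists_polar (S + T)
  have hV' : ‖star V‖ ≤ 1 := by rwa [norm_star]
  refine le_trans ?_ (add_le_add (tsum_inner_le_eTraceNorm hV' S) (tsum_inner_le_eTraceNorm hV' T))
  rw [← ENNReal.tsum_add]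
  refine ENNReal.tsum_le_tsum fun i => ?_
  rw [hA, mul_add, add_apply, inner_add_right]
  refine le_trans ?_ (enorm_add_le _ _)
  rw [← ofReal_norm]
  exact ENNReal.ofReal_le_ofReal (Complex.re_le_norm _)

theorem eTraceNorm_smul (c : ℂ) (T : X →L[ℂ] X) : eTraceNorm (c • T) = ‖c‖ₑ * eTraceNorm T := by
  rw [eTraceNorm, eTraceNorm, ← ENNReal.tsum_mul_left]
  refine tsum_congr fun i => ?_
  rw [CFC.abs_smul, ← ofReal_norm, ← ENNReal.ofReal_mul (norm_nonneg _)]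
  congr 1
  rw [smul_apply, ← Complex.coe_smul, inner_smul_right, Complex.re_ofReal_mul]

theorem eTraceNorm_zero : eTraceNorm (0 : X →L[ℂ] X) = 0 := by simp [eTraceNorm]

theorem eq_zero_of_eTraceNorm_eq_zero {T : X →L[ℂ] X} (h : eTraceNorm T = 0) : T = 0 := by
  rw [eTraceNorm_eq_hsNormSq, hsNormSq, ENNReal.tsum_eq_zero] at h
  have hb : ∀ i, CFC.sqrt (CFC.abs T) (stdBasis X i) = 0 := fun i => by simpa using h i
  have h0 : hsNormSq (star (CFC.sqrt (CFC.abs T))) = 0 := by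
    rw [hsNormSq_adjoint]; simp [hsNormSq, hb]
  have hR : CFC.sqrt (CFC.abs T) = 0 := by
    refine ContinuousLinearMap.ext_on (s := Set.range (stdBasis X)) ?_ ?_
    · have := (stdBasis X).dense_span
      rw [Submodule.dense_iff_topologicalClosure_eq_top]; exact this
    · rintro _ ⟨i, rfl⟩; simpa using hb i
  have hA : CFC.abs T = 0 := by
    rw [← CFC.sqrt_mul_sqrt_self (CFC.abs T) (CFC.abs_nonneg T), hR, mul_zero]
  exact CFC.abs_eq_zero_iff.1 hA

variable (X) in
/-- The trace-class operators as a linear subspace of the bounded operators. -/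
def traceClassSubmodule : Submodule ℂ (X →L[ℂ] X) where
  carrier := {T | IsTraceClass T}
  zero_mem' := (isTraceClass_iff _).2 (by simp [eTraceNorm_zero])
  add_mem' {S T} hS hT := (isTraceClass_iff _).2
    (ne_top_of_le_ne_top
      (ENNReal.add_ne_top.2 ⟨(isTraceClass_iff _).1 hS, (isTraceClass_iff _).1 hT⟩)
      (eTraceNorm_add_le S T))
  smul_mem' c T hT := (isTraceClass_iff _).2 (by
    rw [eTraceNorm_smul]
    exact ENNReal.mul_ne_top enorm_ne_top ((isTraceClass_iff _).1 hT))

variable (X) in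
/-- The space of trace-class operators on `X`. It carries the trace norm (and not the operator
norm that it would inherit as a subspace of the bounded operators). -/
def TraceClass : Type u := ↥(traceClassSubmodule X)

namespace TraceClass

instance : AddCommGroup (TraceClass X) :=
  inferInstanceAs (AddCommGroup ↥(traceClassSubmodule X))

instance : Module ℂ (TraceClass X) :=
  inferInstanceAs (Module ℂ ↥(traceClassSubmodule X))

/-- The bounded operator underlying a trace-class operator. -/
def toOp (T : TraceClass X) : X →L[ℂ] X := T.1

theorem eTraceNorm_ne_top (T : TraceClass X) : eTraceNorm T.toOp ≠ ⊤ :=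
  (isTraceClass_iff _).1 T.2

instance : NormedAddCommGroup (TraceClass X) :=
  AddGroupNorm.toNormedAddCommGroup
    { toFun := fun T => traceNorm T.toOp
      map_zero' := by
        change traceNorm (0 : X →L[ℂ] X) = 0
        rw [traceNorm_eq_toReal, eTraceNorm_zero, ENNReal.toReal_zero]
      add_le' := fun S T => by
        change traceNorm (S.toOp + T.toOp) ≤ _
        simp only [traceNorm_eq_toReal]
        rw [← ENNReal.toReal_add S.eTraceNorm_ne_top T.eTraceNorm_ne_top]
        exact ENNReal.toReal_mono
          (ENNReal.add_ne_top.2 ⟨S.eTraceNorm_ne_top, T.eTraceNorm_ne_top⟩)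
          (eTraceNorm_add_le _ _)
      neg' := fun T => by
        change traceNorm (-T.toOp) = traceNorm T.toOp
        rw [traceNorm, traceNorm, CFC.abs_neg]
      eq_zero_of_map_eq_zero' := fun T h => by
        rw [traceNorm_eq_toReal, ENNReal.toReal_eq_zero_iff] at h
        exact Subtype.ext (eq_zero_of_eTraceNorm_eq_zero (h.resolve_right T.eTraceNorm_ne_top)) }

instance : NormedSpace ℂ (TraceClass X) where
  norm_smul_le c T := by
    change traceNorm (c • T.toOp) ≤ ‖c‖ * traceNorm T.toOp
    rw [traceNorm_eq_toReal, traceNorm_eq_toReal, eTraceNorm_smul, ENNReal.toReal_mul, toReal_enorm]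

theorem norm_def (T : TraceClass X) : ‖T‖ = traceNorm T.toOp := rfl

end TraceClass

end TraceClassOperators

section Discrimination

variable {X : Type u} [NormedAddCommGroup X] [InnerProductSpace ℂ X] [CompleteSpace X]
  {Y : Type v} [NormedAddCommGroup Y] [InnerProductSpace ℂ Y] [CompleteSpace Y]

variable (X) in
/-- The density operators `D(X)`: positive trace-class operators of trace one. -/
def densityOperators : Set (TraceClass X) := {ρ | ρ.toOp.IsPositive ∧ opTrace ρ.toOp = 1}

/-- The block operator `(T i j)` on the direct sum of `n` copies of `X` is positive. -/
def BlockPositive {n : ℕ} (T : Fin n → Fin n → TraceClass X) : Prop :=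
  ∀ v : Fin n → X, 0 ≤ ∑ i, ∑ j, ⟪v i, (T i j).toOp (v j)⟫_ℂ

/-- Complete positivity: `id_n ⊗ Φ` maps positive operators to positive operators, for all `n`. -/
def IsCompletelyPositive (Φ : TraceClass X →ₗ[ℂ] TraceClass Y) : Prop :=
  ∀ (n : ℕ) (T : Fin n → Fin n → TraceClass X),
    BlockPositive T → BlockPositive fun i j => Φ (T i j)

/-- A subchannel: a completely positive trace-nonincreasing linear map. -/
def IsSubchannel (Φ : TraceClass X →ₗ[ℂ] TraceClass Y) : Prop :=
  IsCompletelyPositive Φ ∧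
    ∀ T : TraceClass X, T.toOp.IsPositive → (opTrace (Φ T).toOp).re ≤ (opTrace T.toOp).re

/-- A quantum channel: a completely positive trace-preserving linear map. -/
def IsChannel (Φ : TraceClass X →ₗ[ℂ] TraceClass Y) : Prop :=
  IsCompletelyPositive Φ ∧ ∀ T : TraceClass X, opTrace (Φ T).toOp = opTrace T.toOp

/-- A finite family of subchannels that compose (sum up to) a channel. -/
def IsSubchannelEnsemble {ι : Type*} [Fintype ι] (Ψ : ι → TraceClass X →ₗ[ℂ] TraceClass Y) : Prop :=
  (∀ i, IsSubchannel (Ψ i)) ∧ IsChannel (∑ i, Ψ i)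

/-- A positive-operator valued measure with outcomes in the finite set `ι`. -/
def IsPOVM {ι : Type*} [Fintype ι] (M : ι → Y →L[ℂ] Y) : Prop :=
  (∀ i, (M i).IsPositive) ∧ ∑ i, M i = 1

/-- The success probability `∑ i, Tr (M i Ψ i(ρ))`. -/
def successProb {ι : Type*} [Fintype ι] (Ψ : ι → TraceClass X →ₗ[ℂ] TraceClass Y)
    (M : ι → Y →L[ℂ] Y) (ρ : TraceClass X) : ℝ :=
  ∑ i, (opTrace (M i ∘L (Ψ i ρ).toOp)).re

/-- The optimal success probability over all measurements. -/
def optimalSuccessProb {ι : Type*} [Fintype ι] (Ψ : ι → TraceClass X →ₗ[ℂ] TraceClass Y)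
    (ρ : TraceClass X) : ℝ :=
  sSup {p | ∃ M : ι → Y →L[ℂ] Y, IsPOVM M ∧ p = successProb Ψ M ρ}

end Discrimination

end QResource

end

open QResource

/-! If ρ is free, it takes part in the supremum, and success probabilities of states are bounded by
1, so the quotient is at most 1.

Conversely, let ρ lie outside the closed convex set F. Hahn–Banach in the trace norm gives a
continuous real functional strictly separating ρ from F. Symmetrised under the adjoint, extended
complex-linearly, rescaled and shifted by a multiple of the trace, it becomes a φ with Tr/2 ≤ φ ≤ Tr
on positive operators (`exists_separating_functional`). No representation of φ by a bounded operator
is needed.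

For orthonormal y, z, one channel measures φ and prepares y or z; the other prepares them swapped.
For equal priors a measurement M succeeds on σ with probability (1 + (2φ(σ) - 1)(⟨y, M₀ y⟩ - ⟨z, M₀
z⟩)) / 2. As φ(σ) ≥ 1/2, the optimum is exactly φ(σ), attained at M₀ = |y⟩⟨y|, so strict separation
is a strict advantage (`exists_channels_one_lt`). Halved channels are subchannels, so (iii) implies
(ii).

Attainment is Helstrom's argument: up to a constant, the success probability is Tr(M₀(Ψ₀η - Ψ₁η)),
maximised by the projection onto the closed range of the positive part
(`exists_projection_opTrace_max`). The trace calculus rests on factoring trace-class operators into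
Hilbert–Schmidt ones. -/

namespace QResource

/-! ### Hilbert–Schmidt operators and cyclicity of the trace -/

section HilbertSchmidt

variable {X : Type*} [NormedAddCommGroup X] [InnerProductSpace ℂ X] [CompleteSpace X]

/-- Hilbert–Schmidt operators. -/
def IsHilbertSchmidt (B : X →L[ℂ] X) : Prop := hsNormSq B ≠ ⊤

theorem IsHilbertSchmidt.star {B : X →L[ℂ] X} (hB : IsHilbertSchmidt B) :
    IsHilbertSchmidt (star B) := by
  rwa [IsHilbertSchmidt, hsNormSq_adjoint]

theorem IsHilbertSchmidt.mul_left (C : X →L[ℂ] X) {B : X →L[ℂ] X} (hB : IsHilbertSchmidt B) :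
    IsHilbertSchmidt (C * B) := by
  have h : hsNormSq (C * B) ≤ ‖C‖ₑ ^ 2 * hsNormSq B := by
    rw [hsNormSq, hsNormSq, ← ENNReal.tsum_mul_left]
    refine ENNReal.tsum_le_tsum fun i => ?_
    rw [← mul_pow]
    gcongr
    exact C.le_opENorm _
  exact ne_top_of_le_ne_top
    (ENNReal.mul_ne_top (ENNReal.pow_ne_top enorm_ne_top) hB) h

omit [CompleteSpace X] in
theorem enorm_inner_le_sq (x y : X) : ‖⟪x, y⟫_ℂ‖ₑ ≤ ‖x‖ₑ ^ 2 + ‖y‖ₑ ^ 2 := by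
  rw [← ofReal_norm, ← ofReal_norm, ← ofReal_norm, ← ENNReal.ofReal_pow (norm_nonneg _),
    ← ENNReal.ofReal_pow (norm_nonneg _), ← ENNReal.ofReal_add (by positivity) (by positivity)]
  apply ENNReal.ofReal_le_ofReal
  have := norm_inner_le_norm (𝕜 := ℂ) x y
  nlinarith [sq_nonneg (‖x‖ - ‖y‖), sq_nonneg ‖x‖, sq_nonneg ‖y‖]

theorem IsHilbertSchmidt.tsum_enorm_inner_ne_top {A B : X →L[ℂ] X} (hA : IsHilbertSchmidt A)
    (hB : IsHilbertSchmidt B) :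
    ∑' i, ‖⟪A (stdBasis X i), B (stdBasis X i)⟫_ℂ‖ₑ ≠ ⊤ := by
  refine ne_top_of_le_ne_top (ENNReal.add_ne_top.2 ⟨hA, hB⟩) ?_
  rw [hsNormSq, hsNormSq, ← ENNReal.tsum_add]
  exact ENNReal.tsum_le_tsum fun i => enorm_inner_le_sq _ _

theorem summable_of_tsum_enorm_ne_top {ι : Type*} {f : ι → ℂ} (h : ∑' i, ‖f i‖ₑ ≠ ⊤) :
    Summable f := by
  refine Summable.of_norm ((ENNReal.summable_toReal h).congr fun i => ?_)
  simp

theorem inner_mul_apply (A B : X →L[ℂ] X) (x y : X) :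
    ⟪x, (A * B) y⟫_ℂ = ⟪star A x, B y⟫_ℂ := by
  rw [mul_apply_eq_comp, ContinuousLinearMap.star_eq_adjoint,
    ContinuousLinearMap.adjoint_inner_left]

theorem IsHilbertSchmidt.summable_inner_mul {A B : X →L[ℂ] X} (hA : IsHilbertSchmidt A)
    (hB : IsHilbertSchmidt B) :
    Summable fun i => ⟪stdBasis X i, (A * B) (stdBasis X i)⟫_ℂ := by
  simp only [inner_mul_apply]
  exact summable_of_tsum_enorm_ne_top (hA.star.tsum_enorm_inner_ne_top hB)

/-- By polar decomposition |AB| = (V⋆A)B is again a product of Hilbert–Schmidt operators, so its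
diagonal is summable. -/
theorem IsHilbertSchmidt.isTraceClass_mul {A B : X →L[ℂ] X} (hA : IsHilbertSchmidt A)
    (hB : IsHilbertSchmidt B) : IsTraceClass (A * B) := by
  obtain ⟨V, -, -, hV⟩ := exists_polar (A * B)
  have h := Complex.hasSum_re ((hA.mul_left (Star.star V)).summable_inner_mul hB).hasSum
  rw [IsTraceClass, hV]
  simpa only [mul_assoc] using h.summable

/-- Both traces expand over the basis into the same double series, summed in opposite orders; the
Hilbert–Schmidt bounds make it absolutely convergent. -/
theorem IsHilbertSchmidt.opTrace_mul_comm {A B : X →L[ℂ] X} (hA : IsHilbertSchmidt A)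
    (hB : IsHilbertSchmidt B) : opTrace (A * B) = opTrace (B * A) := by
  set e := stdBasis X
  have key : ∀ C D : X →L[ℂ] X, ∀ i,
      HasSum (fun j => ⟪e i, C (e j)⟫_ℂ * ⟪e j, D (e i)⟫_ℂ) ⟪e i, (C * D) (e i)⟫_ℂ := by
    intro C D i
    have h := e.hasSum_inner_mul_inner (Star.star C (e i)) (D (e i))
    rw [← inner_mul_apply] at h
    simpa only [ContinuousLinearMap.star_eq_adjoint, ContinuousLinearMap.adjoint_inner_left]
      using h
  have hs : Summable (Function.uncurry fun i j => ⟪e i, A (e j)⟫_ℂ * ⟪e j, B (e i)⟫_ℂ) := by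
    apply summable_of_tsum_enorm_ne_top
    have hb : ∑' p : basisSet X × basisSet X,
        (‖⟪e p.1, A (e p.2)⟫_ℂ‖ₑ ^ 2 + ‖⟪e p.2, B (e p.1)⟫_ℂ‖ₑ ^ 2) ≠ ⊤ := by
      rw [ENNReal.tsum_add, ENNReal.tsum_prod (f := fun a b => ‖⟪e a, A (e b)⟫_ℂ‖ₑ ^ 2),
        ENNReal.tsum_comm, ENNReal.tsum_prod (f := fun a b => ‖⟪e b, B (e a)⟫_ℂ‖ₑ ^ 2)]
      simp only [e, parseval]
      exact ENNReal.add_ne_top.2 ⟨hA, hB⟩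
    refine ne_top_of_le_ne_top hb (ENNReal.tsum_le_tsum fun p => ?_)
    -- The product of two matrix entries is read as an inner product in ℂ, whence the conjugate.
    have := enorm_inner_le_sq (X := ℂ) (starRingEnd ℂ ⟪e p.1, A (e p.2)⟫_ℂ) ⟪e p.2, B (e p.1)⟫_ℂ
    simpa [Function.uncurry, mul_comm, -inner_conj_symm] using this
  have h1 : opTrace (A * B) = ∑' i, ∑' j, ⟪e i, A (e j)⟫_ℂ * ⟪e j, B (e i)⟫_ℂ :=
    tsum_congr fun i => (key A B i).tsum_eq.symm
  have h2 : opTrace (B * A) = ∑' j, ∑' i, ⟪e i, A (e j)⟫_ℂ * ⟪e j, B (e i)⟫_ℂ := by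
    refine tsum_congr fun j => ?_
    rw [← (key B A j).tsum_eq]
    exact tsum_congr fun i => mul_comm _ _
  rw [h1, h2, hs.tsum_comm]

end HilbertSchmidt

/-! ### Trace-class operators and the optimal effect -/

section Trace

variable {X : Type*} [NormedAddCommGroup X] [InnerProductSpace ℂ X] [CompleteSpace X]

theorem IsTraceClass.isHilbertSchmidt_sqrt {T : X →L[ℂ] X} (hT : IsTraceClass T) :
    IsHilbertSchmidt (CFC.sqrt (CFC.abs T)) := by
  rwa [IsHilbertSchmidt, ← eTraceNorm_eq_hsNormSq, ← isTraceClass_iff]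

/-- A trace-class operator is a product of two Hilbert–Schmidt operators. -/
theorem IsTraceClass.exists_mul {T : X →L[ℂ] X} (hT : IsTraceClass T) :
    ∃ A B : X →L[ℂ] X, IsHilbertSchmidt A ∧ IsHilbertSchmidt B ∧ T = A * B := by
  obtain ⟨V, -, hV, -⟩ := exists_polar T
  refine ⟨V * CFC.sqrt (CFC.abs T), CFC.sqrt (CFC.abs T),
    hT.isHilbertSchmidt_sqrt.mul_left V, hT.isHilbertSchmidt_sqrt, ?_⟩
  rw [mul_assoc, CFC.sqrt_mul_sqrt_self _ (CFC.abs_nonneg T), ← hV]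

theorem IsTraceClass.star {T : X →L[ℂ] X} (hT : IsTraceClass T) : IsTraceClass (star T) := by
  obtain ⟨A, B, hA, hB, rfl⟩ := hT.exists_mul
  rw [star_mul]
  exact hB.star.isTraceClass_mul hA.star

theorem IsTraceClass.mul_left (M : X →L[ℂ] X) {T : X →L[ℂ] X} (hT : IsTraceClass T) :
    IsTraceClass (M * T) := by
  obtain ⟨A, B, hA, hB, rfl⟩ := hT.exists_mul
  rw [← mul_assoc]
  exact (hA.mul_left M).isTraceClass_mul hB

theorem IsTraceClass.summable {T : X →L[ℂ] X} (hT : IsTraceClass T) :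
    Summable fun i => ⟪stdBasis X i, T (stdBasis X i)⟫_ℂ := by
  obtain ⟨A, B, hA, hB, rfl⟩ := hT.exists_mul
  exact hA.summable_inner_mul hB

theorem opTrace_add {S T : X →L[ℂ] X} (hS : IsTraceClass S) (hT : IsTraceClass T) :
    opTrace (S + T) = opTrace S + opTrace T := by
  simp only [opTrace, add_apply, inner_add_right]
  exact hS.summable.tsum_add hT.summable

theorem opTrace_smul (c : ℂ) (T : X →L[ℂ] X) : opTrace (c • T) = c * opTrace T := by
  simp only [opTrace, smul_apply, inner_smul_right, tsum_mul_left]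

theorem opTrace_sub {S T : X →L[ℂ] X} (hS : IsTraceClass S) (hT : IsTraceClass T) :
    opTrace (S - T) = opTrace S - opTrace T := by
  simp only [opTrace, sub_apply, inner_sub_right]
  exact hS.summable.tsum_sub hT.summable

theorem TraceClass.isTraceClass (T : TraceClass X) : IsTraceClass T.toOp := T.2

theorem opTrace_nonneg {T : X →L[ℂ] X} (hT : T.IsPositive) : 0 ≤ opTrace T :=
  tsum_nonneg fun _ => hT.inner_nonneg_right _

/-- The trace of the product of two positive operators is nonnegative. -/
theorem opTrace_mul_re_nonneg {M T : X →L[ℂ] X} (hM : M.IsPositive) (hT : T.IsPositive)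
    (hTc : IsTraceClass T) : 0 ≤ (opTrace (M * T)).re := by
  have h0 : 0 ≤ T := (ContinuousLinearMap.nonneg_iff_isPositive T).2 hT
  set R := CFC.sqrt T with hR
  have hRH : IsHilbertSchmidt R := by
    have := hTc.isHilbertSchmidt_sqrt
    rwa [CFC.abs_of_nonneg T h0] at this
  have hs : star R = R := (IsSelfAdjoint.of_nonneg (CFC.sqrt_nonneg T)).star_eq
  have hRR : T = R * R := (CFC.sqrt_mul_sqrt_self T h0).symm
  -- Tr(MRR) = Tr(RMR), whose diagonal entries are ⟨R e, M R e⟩ ≥ 0.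
  rw [hRR, ← mul_assoc, (hRH.mul_left M).opTrace_mul_comm hRH]
  refine (Complex.nonneg_iff.1 (tsum_nonneg fun i => ?_)).1
  rw [inner_mul_apply, hs, mul_apply_eq_comp]
  exact hM.inner_nonneg_right _

theorem IsTraceClass.of_le {S T : X →L[ℂ] X} (hS : 0 ≤ S) (hST : S ≤ T) (hT : IsTraceClass T) :
    IsTraceClass S := by
  have hT0 := hS.trans hST
  rw [IsTraceClass, CFC.abs_of_nonneg T hT0] at hT
  rw [IsTraceClass, CFC.abs_of_nonneg S hS]
  refine Summable.of_nonneg_of_le (fun i => ?_) (fun i => ?_) hT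
  · exact (Complex.nonneg_iff.1
      (((ContinuousLinearMap.nonneg_iff_isPositive S).1 hS).inner_nonneg_right _)).1
  · have := (Complex.nonneg_iff.1
      (((ContinuousLinearMap.le_def S T).1 hST).inner_nonneg_right (stdBasis X i))).1
    rw [sub_apply, inner_sub_right, Complex.sub_re] at this
    linarith

theorem IsTraceClass.abs {T : X →L[ℂ] X} (hT : IsTraceClass T) : IsTraceClass (CFC.abs T) := by
  rwa [IsTraceClass, CFC.cfcAbs_cfcAbs]

/-- Over the effects `0 ≤ M ≤ 1`, the functional `M ↦ Re Tr (M A)` attains its maximum, at the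
projection onto the positive part of `A`. -/
theorem exists_projection_opTrace_max {A : X →L[ℂ] X} (hA : IsSelfAdjoint A)
    (hAc : IsTraceClass A) :
    ∃ P : X →L[ℂ] X, P.IsPositive ∧ (1 - P).IsPositive ∧
      ∀ M : X →L[ℂ] X, M.IsPositive → (1 - M).IsPositive →
        (opTrace (M * A)).re ≤ (opTrace (P * A)).re := by
  have hp0 := CFC.posPart_nonneg A
  have hn0 := CFC.negPart_nonneg A
  have hadd := CFC.posPart_add_negPart A hA
  have hsub := CFC.posPart_sub_negPart A hA
  have hpc : IsTraceClass A⁺ := hAc.abs.of_le hp0 (by rw [← hadd]; exact le_add_of_nonneg_right hn0)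
  have hnc : IsTraceClass A⁻ := hAc.abs.of_le hn0 (by rw [← hadd]; exact le_add_of_nonneg_left hp0)
  let K : Submodule ℂ X := (LinearMap.range ((A⁺ : X →L[ℂ] X) : X →ₗ[ℂ] X)).topologicalClosure
  have : CompleteSpace K := (Submodule.isClosed_topologicalClosure _).completeSpace_coe
  have hP : IsStarProjection K.starProjection := isStarProjection_starProjection
  have h1 : K.starProjection * A⁺ = A⁺ := by
    ext x
    exact Submodule.starProjection_eq_self_iff.2 (Submodule.le_topologicalClosure _ ⟨x, rfl⟩)
  -- Since A⁺A⁻ = 0 with A⁺ self-adjoint, the range of A⁻ is orthogonal to that of A⁺.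
  have h2 : K.starProjection * A⁻ = 0 := by
    ext x
    rw [mul_apply_eq_comp, zero_apply, Submodule.starProjection_apply_eq_zero_iff]
    rw [Submodule.orthogonal_closure, Submodule.mem_orthogonal]
    rintro _ ⟨y, rfl⟩
    have hs : star A⁺ = A⁺ := (IsSelfAdjoint.of_nonneg hp0).star_eq
    change ⟪A⁺ y, A⁻ x⟫_ℂ = 0
    have := inner_mul_apply A⁺ A⁻ y x
    rw [hs, CFC.posPart_mul_negPart] at this
    simpa using this.symm
  refine ⟨K.starProjection, .of_isStarProjection hP, .of_isStarProjection hP.one_sub,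
    fun M hM hM' => ?_⟩
  have e1 : K.starProjection * A = A⁺ := by
    conv_lhs => rw [← hsub]
    rw [mul_sub, h1, h2, sub_zero]
  -- Both terms subtracted from A⁺ = PA are products of positive operators, so their traces have
  -- nonnegative real part.
  have e2 : M * A = A⁺ - (1 - M) * A⁺ - M * A⁻ := by
    conv_lhs => rw [← hsub]
    noncomm_ring
  rw [e1, e2, opTrace_sub, opTrace_sub hpc (hpc.mul_left _), Complex.sub_re, Complex.sub_re]
  · have := opTrace_mul_re_nonneg hM ((ContinuousLinearMap.nonneg_iff_isPositive _).1 hn0) hnc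
    have := opTrace_mul_re_nonneg hM' ((ContinuousLinearMap.nonneg_iff_isPositive _).1 hp0) hpc
    linarith
  · exact (traceClassSubmodule X).sub_mem hpc (hpc.mul_left (1 - M))
  · exact hnc.mul_left M

end Trace

end QResource

namespace QResource

/-! ### Positive functionals, completely positive maps and separation -/

section Maps

variable {X : Type*} [NormedAddCommGroup X] [InnerProductSpace ℂ X] [CompleteSpace X]
  {Y : Type*} [NormedAddCommGroup Y] [InnerProductSpace ℂ Y] [CompleteSpace Y]

omit [CompleteSpace X] in
theorem isPositive_of_inner_nonneg {T : X →L[ℂ] X} (h : ∀ x, 0 ≤ ⟪x, T x⟫_ℂ) :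
    T.IsPositive := by
  rw [ContinuousLinearMap.isPositive_iff_complex]
  intro x
  have h1 := Complex.nonneg_iff.1 (h x)
  have e : ⟪T x, x⟫_ℂ = ⟪x, T x⟫_ℂ := by
    rw [← inner_conj_symm]
    exact Complex.conj_eq_iff_im.2 h1.2.symm
  rw [e]
  exact ⟨Complex.ext rfl h1.2, h1.1⟩

namespace TraceClass

@[simp] theorem toOp_add (S T : TraceClass X) : (S + T).toOp = S.toOp + T.toOp := rfl

@[simp] theorem toOp_sub (S T : TraceClass X) : (S - T).toOp = S.toOp - T.toOp := rfl

@[simp] theorem toOp_smul (c : ℂ) (T : TraceClass X) : (c • T).toOp = c • T.toOp := rfl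

/-- The inclusion into the bounded operators. -/
def toOpₗ : TraceClass X →ₗ[ℂ] X →L[ℂ] X where
  toFun := toOp
  map_add' _ _ := rfl
  map_smul' _ _ := rfl

@[simp] theorem toOp_sum {ι : Type*} (s : Finset ι) (T : ι → TraceClass X) :
    (∑ i ∈ s, T i).toOp = ∑ i ∈ s, (T i).toOp := map_sum toOpₗ T s

/-- The trace as a linear functional. -/
noncomputable def trace : TraceClass X →ₗ[ℂ] ℂ where
  toFun T := opTrace T.toOp
  map_add' S T := opTrace_add S.isTraceClass T.isTraceClass
  map_smul' c T := opTrace_smul c T.toOp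

theorem trace_apply (T : TraceClass X) : trace T = opTrace T.toOp := rfl

/-- The adjoint, as a real-linear map. -/
noncomputable def adjoint : TraceClass X →ₗ[ℝ] TraceClass X where
  toFun T := ⟨star T.toOp, T.isTraceClass.star⟩
  map_add' S T := Subtype.ext (star_add S.toOp T.toOp)
  map_smul' r T := Subtype.ext <| by
    change star ((r : ℂ) • T.toOp) = (r : ℂ) • star T.toOp
    rw [star_smul]
    simp

theorem adjoint_eq_self {T : TraceClass X} (hT : T.toOp.IsPositive) : adjoint T = T :=
  Subtype.ext hT.isSelfAdjoint.star_eq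

theorem adjoint_I_smul {T : TraceClass X} (hT : T.toOp.IsPositive) :
    adjoint (Complex.I • T) = -(Complex.I • T) := by
  refine Subtype.ext ?_
  change star (Complex.I • T.toOp) = -(Complex.I • T.toOp)
  rw [star_smul, hT.isSelfAdjoint.star_eq]
  simp

/-- Here |T| = T. This turns the norm bound on a continuous functional into a comparison with the
trace on the positive cone. -/
theorem norm_eq_opTrace {T : TraceClass X} (hT : T.toOp.IsPositive) :
    ((‖T‖ : ℝ) : ℂ) = opTrace T.toOp := by
  have h0 : 0 ≤ T.toOp := (ContinuousLinearMap.nonneg_iff_isPositive _).2 hT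
  rw [norm_def, traceNorm, CFC.abs_of_nonneg _ h0, Complex.ofReal_tsum, opTrace]
  refine tsum_congr fun i => ?_
  have := Complex.nonneg_iff.1 (hT.inner_nonneg_right (stdBasis X i))
  exact Complex.ext (by simp) (by simpa using this.2)

/-- The rank-one operator `|y⟩⟨y|`. -/
noncomputable def pure (y : Y) : TraceClass Y :=
  ⟨InnerProductSpace.rankOne ℂ y y, by
    have hHS : ∀ z : Y, IsHilbertSchmidt (InnerProductSpace.rankOne ℂ z z) := by
      intro z
      have : ∀ i, ‖InnerProductSpace.rankOne ℂ z z (stdBasis Y i)‖ₑ ^ 2 =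
          ‖⟪stdBasis Y i, z⟫_ℂ‖ₑ ^ 2 * ‖z‖ₑ ^ 2 := by
        intro i
        rw [InnerProductSpace.rankOne_apply, enorm_smul, mul_pow, ← ofReal_norm ⟪z, _⟫_ℂ,
          norm_inner_symm, ofReal_norm]
      rw [IsHilbertSchmidt, hsNormSq]
      simp only [this]
      rw [ENNReal.tsum_mul_right, parseval]
      exact ENNReal.mul_ne_top (ENNReal.pow_ne_top enorm_ne_top)
        (ENNReal.pow_ne_top enorm_ne_top)
    rcases eq_or_ne y 0 with rfl | hy
    · simp
    -- |y⟩⟨y|² = ⟨y, y⟩ |y⟩⟨y|, so for y ≠ 0 the operator is a multiple of a product of two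
    -- Hilbert–Schmidt operators.
    · have h := (traceClassSubmodule Y).smul_mem (⟪y, y⟫_ℂ)⁻¹ ((hHS y).isTraceClass_mul (hHS y))
      convert h using 1
      ext x
      have : ⟪y, y⟫_ℂ ≠ 0 := inner_self_ne_zero.2 hy
      simp only [smul_apply, mul_apply_eq_comp, InnerProductSpace.rankOne_apply, inner_smul_right,
        smul_smul]
      congr 1
      field_simp⟩

theorem pure_toOp_apply (y z : Y) : (pure y).toOp z = ⟪y, z⟫_ℂ • y := rfl

/-- The diagonal of M|y⟩⟨y| is the basis expansion of ⟨y, M y⟩. -/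
theorem opTrace_mul_pure (M : Y →L[ℂ] Y) (y : Y) :
    opTrace (M * (pure y).toOp) = ⟪y, M y⟫_ℂ := by
  rw [← ((stdBasis Y).hasSum_inner_mul_inner y (M y)).tsum_eq]
  refine tsum_congr fun i => ?_
  rw [mul_apply_eq_comp, pure_toOp_apply, map_smul, inner_smul_right]

end TraceClass

theorem IsCompletelyPositive.isPositive {Φ : TraceClass X →ₗ[ℂ] TraceClass Y}
    (hΦ : IsCompletelyPositive Φ) {T : TraceClass X} (hT : T.toOp.IsPositive) :
    (Φ T).toOp.IsPositive := by
  refine isPositive_of_inner_nonneg fun y => ?_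
  have := hΦ 1 (fun _ _ => T) (fun v => by simpa using hT.inner_nonneg_right (v 0)) fun _ => y
  simpa using this

theorem IsCompletelyPositive.add {Φ Ψ : TraceClass X →ₗ[ℂ] TraceClass Y}
    (hΦ : IsCompletelyPositive Φ) (hΨ : IsCompletelyPositive Ψ) :
    IsCompletelyPositive (Φ + Ψ) := by
  intro n T hT v
  have := add_nonneg (hΦ n T hT v) (hΨ n T hT v)
  simpa [← Finset.sum_add_distrib, inner_add_right] using this

theorem IsCompletelyPositive.smul {Φ : TraceClass X →ₗ[ℂ] TraceClass Y}
    (hΦ : IsCompletelyPositive Φ) {c : ℂ} (hc : 0 ≤ c) : IsCompletelyPositive (c • Φ) := by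
  intro n T hT v
  have := mul_nonneg hc (hΦ n T hT v)
  simpa [Finset.mul_sum, inner_smul_right] using this

/-- Measuring a positive functional and preparing a pure state is completely positive. -/
theorem isCompletelyPositive_smulRight {φ : TraceClass X →ₗ[ℂ] ℂ}
    (hφ : ∀ T : TraceClass X, T.toOp.IsPositive → 0 ≤ φ T) (y : Y) :
    IsCompletelyPositive (φ.smulRight (TraceClass.pure y)) := by
  intro n T hT v
  -- The output's block form at v is φ of this single operator, whose quadratic form at x is the
  -- block form of T at the vectors ⟨y, v i⟩ x.
  have h : 0 ≤ φ (∑ i, ∑ j, (⟪v i, y⟫_ℂ * ⟪y, v j⟫_ℂ) • T i j) := by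
    refine hφ _ (isPositive_of_inner_nonneg fun x => ?_)
    have := hT fun i => ⟪y, v i⟫_ℂ • x
    simpa [inner_sum, sum_apply, inner_smul_left, inner_smul_right, mul_comm,
      mul_left_comm, mul_assoc] using this
  convert h using 1
  rw [map_sum]
  refine Finset.sum_congr rfl fun i _ => ?_
  rw [map_sum]
  refine Finset.sum_congr rfl fun j _ => ?_
  simp only [LinearMap.smulRight_apply, TraceClass.toOp_smul, smul_apply,
    TraceClass.pure_toOp_apply, inner_smul_right, map_smul, smul_eq_mul]
  ring

/-- A positive functional dominated by the trace that strictly separates a state from a closed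
convex set of states. -/
theorem exists_separating_functional {F : Set (TraceClass X)} (hFD : F ⊆ densityOperators X)
    (hFconv : Convex ℝ F) (hFclosed : IsClosed F) {ρ : TraceClass X}
    (hρ : ρ ∈ densityOperators X) (hρF : ρ ∉ F) :
    ∃ φ : TraceClass X →ₗ[ℂ] ℂ,
      (∀ T : TraceClass X, T.toOp.IsPositive →
        2⁻¹ * opTrace T.toOp ≤ φ T ∧ φ T ≤ opTrace T.toOp) ∧
      ∃ s : ℝ, (∀ σ ∈ F, (φ σ).re ≤ s) ∧ s < (φ ρ).re := by
  obtain ⟨f, u, hfF, hfρ⟩ := geometric_hahn_banach_closed_point hFconv hFclosed hρF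
  -- Averaging with the adjoint kills f on iT for T positive, so the complex extension is real and
  -- equal to f on positive operators.
  let f₁ : TraceClass X →ₗ[ℝ] ℝ :=
    (2⁻¹ : ℝ) • (f.toLinearMap + f.toLinearMap ∘ₗ TraceClass.adjoint)
  let g : TraceClass X →ₗ[ℂ] ℂ := Module.Dual.extendRCLike f₁
  have hg : ∀ T : TraceClass X, T.toOp.IsPositive → g T = (f T : ℂ) := by
    intro T hT
    have h1 : f₁ T = f T := by
      change (2⁻¹ : ℝ) * (f T + f (TraceClass.adjoint T)) = f T
      rw [TraceClass.adjoint_eq_self hT]; ring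
    have h2 : f₁ (Complex.I • T) = 0 := by
      change (2⁻¹ : ℝ) * (f (Complex.I • T) + f (TraceClass.adjoint (Complex.I • T))) = 0
      rw [TraceClass.adjoint_I_smul hT, map_neg]; ring
    rw [show g T = ((f₁ T : ℝ) : ℂ) - Complex.I * ((f₁ (Complex.I • T) : ℝ) : ℂ) from rfl, h1, h2]
    simp
  -- With this c, |f T| / c ≤ ‖T‖ / 4; adding 3/4 of the trace places φ between Tr/2 and Tr. The
  -- summand 1 keeps c positive.
  set c : ℝ := 4 * (‖f‖ + 1) with hc
  have hcpos : 0 < c := by positivity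
  let φ : TraceClass X →ₗ[ℂ] ℂ := (3 / 4 : ℂ) • TraceClass.trace + ((c⁻¹ : ℝ) : ℂ) • g
  have hφ : ∀ T : TraceClass X, T.toOp.IsPositive →
      φ T = ((3 / 4 * ‖T‖ + c⁻¹ * f T : ℝ) : ℂ) := by
    intro T hT
    change (3 / 4 : ℂ) * TraceClass.trace T + ((c⁻¹ : ℝ) : ℂ) * g T = _
    rw [hg T hT, TraceClass.trace_apply, ← TraceClass.norm_eq_opTrace hT]
    push_cast; rfl
  have hnorm : ∀ σ ∈ densityOperators X, ‖σ‖ = 1 := by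
    intro σ hσ
    have := TraceClass.norm_eq_opTrace hσ.1
    rw [hσ.2] at this
    exact_mod_cast this
  -- States have trace norm 1, so the shift is constant on them and the threshold u becomes 3/4 +
  -- u/c.
  refine ⟨φ, fun T hT => ?_, 3 / 4 + c⁻¹ * u, fun σ hσ => ?_, ?_⟩
  · have h1 : |c⁻¹ * f T| ≤ 4⁻¹ * ‖T‖ := by
      rw [abs_mul, abs_of_pos (inv_pos.2 hcpos), inv_mul_le_iff₀ hcpos, hc]
      have := f.le_opNorm T
      rw [Real.norm_eq_abs] at this
      nlinarith [norm_nonneg T]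
    have h2 := abs_le.1 h1
    rw [hφ T hT, ← TraceClass.norm_eq_opTrace hT]
    constructor
    · rw [show (2⁻¹ : ℂ) * ((‖T‖ : ℝ) : ℂ) = ((2⁻¹ * ‖T‖ : ℝ) : ℂ) by push_cast; rfl]
      exact Complex.real_le_real.2 (by linarith)
    · exact Complex.real_le_real.2 (by linarith)
  · rw [hφ σ (hFD hσ).1, hnorm σ (hFD hσ), Complex.ofReal_re, mul_one]
    have := hfF σ hσ
    gcongr
  · rw [hφ ρ hρ.1, hnorm ρ hρ, Complex.ofReal_re, mul_one]
    gcongr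

omit [CompleteSpace Y] in
theorem exists_orthonormal_pair (hY : 2 ≤ Module.rank ℂ Y) :
    ∃ y z : Y, ‖y‖ = 1 ∧ ‖z‖ = 1 ∧ ⟪y, z⟫_ℂ = 0 := by
  obtain ⟨f, hf⟩ := exists_linearIndependent_of_le_rank (R := ℂ) (M := Y) (n := 2)
    (by exact_mod_cast hY)
  have h := InnerProductSpace.gramSchmidtNormed_orthonormal hf
  exact ⟨_, _, h.1 0, h.1 1, h.2 (by decide : (0 : Fin 2) ≠ 1)⟩

end Maps
end QResource

namespace QResource

/-! ### Success probabilities and discrimination of two channels -/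

section Discrimination

variable {X : Type*} [NormedAddCommGroup X] [InnerProductSpace ℂ X] [CompleteSpace X]
  {Y : Type*} [NormedAddCommGroup Y] [InnerProductSpace ℂ Y] [CompleteSpace Y]
  {ι : Type*} [Fintype ι] {Ψ : ι → TraceClass X →ₗ[ℂ] TraceClass Y}

omit [CompleteSpace Y] in
theorem isPOVM_pair {P : Y →L[ℂ] Y} (hP : P.IsPositive) (hP' : (1 - P).IsPositive) :
    IsPOVM ![P, 1 - P] := by
  refine ⟨fun i => ?_, by simp⟩
  fin_cases i
  exacts [hP, hP']

theorem IsPOVM.isPositive_one_sub {M : ι → Y →L[ℂ] Y} (hM : IsPOVM M) (i : ι) :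
    (1 - M i).IsPositive := by
  classical
  rw [← hM.2, ← ContinuousLinearMap.nonneg_iff_isPositive,
    ← Finset.sum_erase_eq_sub (Finset.mem_univ i)]
  exact Finset.sum_nonneg fun j _ => (ContinuousLinearMap.nonneg_iff_isPositive _).2 (hM.1 j)

/-- Each effect is at most 1 and the outputs have total trace 1. This bound makes the real suprema
meaningful. -/
theorem IsSubchannelEnsemble.successProb_le_one (hΨ : IsSubchannelEnsemble Ψ)
    {M : ι → Y →L[ℂ] Y} (hM : IsPOVM M) {η : TraceClass X} (hη : η ∈ densityOperators X) :
    successProb Ψ M η ≤ 1 := by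
  have h1 : ∀ i, (opTrace (M i ∘L (Ψ i η).toOp)).re ≤ (TraceClass.trace (Ψ i η)).re := by
    intro i
    have h := opTrace_mul_re_nonneg (hM.isPositive_one_sub i) ((hΨ.1 i).1.isPositive hη.1)
      (Ψ i η).isTraceClass
    rw [sub_mul, one_mul, opTrace_sub (Ψ i η).isTraceClass ((Ψ i η).isTraceClass.mul_left _),
      Complex.sub_re] at h
    exact sub_nonneg.1 h
  have h2 : ∑ i, TraceClass.trace (Ψ i η) = 1 := by
    have := hΨ.2.2 η
    rwa [hη.2, ← TraceClass.trace_apply, LinearMap.sum_apply, map_sum] at this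
  calc successProb Ψ M η ≤ ∑ i, (TraceClass.trace (Ψ i η)).re := Finset.sum_le_sum fun i _ => h1 i
    _ = 1 := by rw [← Complex.re_sum, h2, Complex.one_re]

theorem IsSubchannelEnsemble.successProb_le_optimal (hΨ : IsSubchannelEnsemble Ψ)
    {M : ι → Y →L[ℂ] Y} (hM : IsPOVM M) {η : TraceClass X} (hη : η ∈ densityOperators X) :
    successProb Ψ M η ≤ optimalSuccessProb Ψ η :=
  le_csSup ⟨1, by rintro _ ⟨M', hM', rfl⟩; exact hΨ.successProb_le_one hM' hη⟩ ⟨M, hM, rfl⟩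

theorem optimalSuccessProb_le {Ψ : Fin 2 → TraceClass X →ₗ[ℂ] TraceClass Y} {η : TraceClass X}
    {c : ℝ} (h : ∀ M, IsPOVM M → successProb Ψ M η ≤ c) : optimalSuccessProb Ψ η ≤ c := by
  -- The trivial measurement (1, 0) shows that the supremum is over a nonempty set.
  refine csSup_le ⟨_, ![1, 1 - 1], isPOVM_pair ?_ ?_, rfl⟩ ?_
  · exact ContinuousLinearMap.isPositive_one
  · simp
  · rintro _ ⟨M, hM, rfl⟩
    exact h M hM

theorem optimalSuccessProb_nonneg {Ψ : Fin 2 → TraceClass X →ₗ[ℂ] TraceClass Y}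
    (hΨ : IsSubchannelEnsemble Ψ) {η : TraceClass X} (hη : η ∈ densityOperators X) :
    0 ≤ optimalSuccessProb Ψ η := by
  have hM : IsPOVM ![(1 : Y →L[ℂ] Y), 1 - 1] :=
    isPOVM_pair ContinuousLinearMap.isPositive_one (by simp)
  refine le_trans (Finset.sum_nonneg fun i _ => ?_) (hΨ.successProb_le_optimal hM hη)
  exact opTrace_mul_re_nonneg (hM.1 i) ((hΨ.1 i).1.isPositive hη.1) (Ψ i η).isTraceClass

/-- A free state gives no advantage. -/
theorem optimalSuccessProb_div_le_one {F : Set (TraceClass X)} (hFD : F ⊆ densityOperators X)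
    {Ψ : Fin 2 → TraceClass X →ₗ[ℂ] TraceClass Y} (hΨ : IsSubchannelEnsemble Ψ)
    {σ : TraceClass X} (hσ : σ ∈ F) :
    optimalSuccessProb Ψ σ / sSup (optimalSuccessProb Ψ '' F) ≤ 1 := by
  have h : optimalSuccessProb Ψ σ ≤ sSup (optimalSuccessProb Ψ '' F) := by
    refine le_csSup ⟨1, ?_⟩ ⟨σ, hσ, rfl⟩
    rintro _ ⟨τ, hτ, rfl⟩
    exact optimalSuccessProb_le fun M hM => hΨ.successProb_le_one hM (hFD hτ)
  -- A nonnegative denominator suffices, since division by zero gives 0.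
  exact div_le_one_of_le₀ h ((optimalSuccessProb_nonneg hΨ (hFD hσ)).trans h)

/-- Equiprobable channels form an ensemble of subchannels. -/
theorem isSubchannelEnsemble_half {Λ : Fin 2 → TraceClass X →ₗ[ℂ] TraceClass Y}
    (hΛ : ∀ i, IsChannel (Λ i)) : IsSubchannelEnsemble fun i => (1 / 2 : ℂ) • Λ i := by
  have h0 : (0 : ℂ) ≤ 1 / 2 := by
    rw [show (1 / 2 : ℂ) = ((1 / 2 : ℝ) : ℂ) by push_cast; rfl]
    exact Complex.zero_le_real.2 (by norm_num)
  have htr : ∀ i T, opTrace (((1 / 2 : ℂ) • Λ i) T).toOp = 1 / 2 * opTrace T.toOp := by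
    intro i T
    rw [LinearMap.smul_apply, TraceClass.toOp_smul, opTrace_smul, (hΛ i).2]
  refine ⟨fun i => ⟨(hΛ i).1.smul h0, fun T hT => ?_⟩, ?_, fun T => ?_⟩
  · have := (Complex.nonneg_iff.1 (opTrace_nonneg hT)).1
    rw [htr, show (1 / 2 : ℂ) = ((1 / 2 : ℝ) : ℂ) by push_cast; rfl, Complex.re_ofReal_mul]
    linarith
  · rw [Fin.sum_univ_two]
    exact ((hΛ 0).1.smul h0).add ((hΛ 1).1.smul h0)
  · rw [Fin.sum_univ_two, LinearMap.add_apply, TraceClass.toOp_add,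
      opTrace_add (TraceClass.isTraceClass _) (TraceClass.isTraceClass _), htr, htr]
    ring

/-- The maximum of the success probability is attained. -/
theorem exists_optimal_measurement {Ψ : Fin 2 → TraceClass X →ₗ[ℂ] TraceClass Y}
    (hΨ : IsSubchannelEnsemble Ψ) {η : TraceClass X} (hη : η ∈ densityOperators X) :
    ∃ M : Fin 2 → Y →L[ℂ] Y, IsPOVM M ∧
      ∀ M' : Fin 2 → Y →L[ℂ] Y, IsPOVM M' → successProb Ψ M' η ≤ successProb Ψ M η := by
  have h0 := (hΨ.1 0).1.isPositive hη.1
  have h1 := (hΨ.1 1).1.isPositive hη.1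
  obtain ⟨P, hP, hP', hmax⟩ := exists_projection_opTrace_max
    (h0.isSelfAdjoint.sub h1.isSelfAdjoint) (Ψ 0 η - Ψ 1 η).isTraceClass
  -- Eliminating M₁ = 1 - M₀ leaves a constant plus a linear functional of the effect M₀.
  have key : ∀ M : Fin 2 → Y →L[ℂ] Y, IsPOVM M → successProb Ψ M η =
      (opTrace (M 0 * (Ψ 0 η - Ψ 1 η).toOp)).re + (opTrace (Ψ 1 η).toOp).re := by
    intro M hM
    have hM1 : M 1 = 1 - M 0 := by
      rw [← hM.2, Fin.sum_univ_two, add_sub_cancel_left]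
    have c0 := (Ψ 0 η).isTraceClass
    have c1 := (Ψ 1 η).isTraceClass
    simp only [successProb, Fin.sum_univ_two, ← ContinuousLinearMap.mul_def]
    rw [hM1, TraceClass.toOp_sub, mul_sub, sub_mul, one_mul,
      opTrace_sub (c0.mul_left _) (c1.mul_left _), opTrace_sub c1 (c1.mul_left _),
      Complex.sub_re, Complex.sub_re]
    ring
  refine ⟨![P, 1 - P], isPOVM_pair hP hP', fun M hM => ?_⟩
  rw [key M hM, key _ (isPOVM_pair hP hP')]
  refine add_le_add_left ?_ _
  exact hmax _ (hM.1 0) (hM.isPositive_one_sub 0)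

/-- The measure-and-prepare map `T ↦ φ(T) |y⟩⟨y| + (Tr T - φ(T)) |z⟩⟨z|`. -/
noncomputable def measurePrepare (φ : TraceClass X →ₗ[ℂ] ℂ) (y z : Y) :
    TraceClass X →ₗ[ℂ] TraceClass Y :=
  φ.smulRight (TraceClass.pure y) + (TraceClass.trace - φ).smulRight (TraceClass.pure z)

theorem opTrace_mul_measurePrepare (φ : TraceClass X →ₗ[ℂ] ℂ) (y z : Y) (M : Y →L[ℂ] Y)
    (T : TraceClass X) : opTrace (M * (measurePrepare φ y z T).toOp) =
      φ T * ⟪y, M y⟫_ℂ + (opTrace T.toOp - φ T) * ⟪z, M z⟫_ℂ := by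
  have h : M * (measurePrepare φ y z T).toOp = φ T • (M * (TraceClass.pure y).toOp) +
      (opTrace T.toOp - φ T) • (M * (TraceClass.pure z).toOp) := by
    rw [← mul_smul_comm, ← mul_smul_comm, ← mul_add]
    rfl
  rw [h, opTrace_add, opTrace_smul, opTrace_smul, TraceClass.opTrace_mul_pure,
    TraceClass.opTrace_mul_pure]
  · exact (traceClassSubmodule Y).smul_mem _ ((TraceClass.isTraceClass _).mul_left M)
  · exact (traceClassSubmodule Y).smul_mem _ ((TraceClass.isTraceClass _).mul_left M)

/-- The weights φ and Tr - φ are nonnegative on positive operators, and on unit vectors they add up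
to the trace; the latter is the trace formula at M = 1. -/
theorem isChannel_measurePrepare {φ : TraceClass X →ₗ[ℂ] ℂ}
    (hφ : ∀ T : TraceClass X, T.toOp.IsPositive → 0 ≤ φ T ∧ φ T ≤ opTrace T.toOp)
    {y z : Y} (hy : ‖y‖ = 1) (hz : ‖z‖ = 1) : IsChannel (measurePrepare φ y z) := by
  refine ⟨(isCompletelyPositive_smulRight (fun T hT => (hφ T hT).1) y).add
    (isCompletelyPositive_smulRight (fun T hT => sub_nonneg.2 (hφ T hT).2) z), fun T => ?_⟩
  have h := opTrace_mul_measurePrepare φ y z 1 T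
  rw [one_mul, one_apply_eq_self, one_apply_eq_self, inner_self_eq_norm_sq_to_K,
    inner_self_eq_norm_sq_to_K, hy, hz] at h
  rw [h]
  simp

/-- A state outside the free states improves the discrimination of some pair of channels. -/
theorem exists_channels_one_lt (hY : 2 ≤ Module.rank ℂ Y) {F : Set (TraceClass X)}
    (hFD : F ⊆ densityOperators X) (hFne : F.Nonempty) (hFconv : Convex ℝ F)
    (hFclosed : IsClosed F) {ρ : TraceClass X} (hρ : ρ ∈ densityOperators X) (hρF : ρ ∉ F) :
    ∃ Λ : Fin 2 → TraceClass X →ₗ[ℂ] TraceClass Y, (∀ i, IsChannel (Λ i)) ∧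
      1 < optimalSuccessProb (fun i => (1 / 2 : ℂ) • Λ i) ρ /
        sSup (optimalSuccessProb (fun i => (1 / 2 : ℂ) • Λ i) '' F) := by
  obtain ⟨φ, hφ, s, hs, hsρ⟩ := exists_separating_functional hFD hFconv hFclosed hρ hρF
  obtain ⟨y, z, hy, hz, hyz⟩ := exists_orthonormal_pair hY
  have hφ' : ∀ T : TraceClass X, T.toOp.IsPositive → 0 ≤ φ T ∧ φ T ≤ opTrace T.toOp :=
    fun T hT => ⟨(mul_nonneg (by simp) (opTrace_nonneg hT)).trans (hφ T hT).1,
      (hφ T hT).2⟩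
  let Λ : Fin 2 → TraceClass X →ₗ[ℂ] TraceClass Y :=
    ![measurePrepare φ y z, measurePrepare φ z y]
  have hΛ : ∀ i, IsChannel (Λ i) := by
    intro i
    fin_cases i
    exacts [isChannel_measurePrepare hφ' hy hz, isChannel_measurePrepare hφ' hz hy]
  have hΨ := isSubchannelEnsemble_half hΛ
  have hreal : ∀ σ ∈ densityOperators X, φ σ = ((φ σ).re : ℂ) ∧ 1 / 2 ≤ (φ σ).re := by
    intro σ hσ
    refine ⟨Complex.ext rfl (by simpa using (Complex.nonneg_iff.1 (hφ' σ hσ.1).1).2.symm), ?_⟩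
    have := (Complex.le_def.1 (hφ σ hσ.1).1).1
    rw [hσ.2] at this
    norm_num at this
    linarith
  have hprob : ∀ σ ∈ densityOperators X, ∀ M : Fin 2 → Y →L[ℂ] Y, IsPOVM M →
      successProb (fun i => (1 / 2 : ℂ) • Λ i) M σ = 2⁻¹ * (1 +
        (2 * (φ σ).re - 1) * ((⟪y, M 0 y⟫_ℂ).re - (⟪z, M 0 z⟫_ℂ).re)) := by
    intro σ hσ M hM
    have hM1 : M 1 = 1 - M 0 := by
      rw [← hM.2, Fin.sum_univ_two, add_sub_cancel_left]
    have hc : ∀ i, opTrace (M i ∘L (((1 / 2 : ℂ) • Λ i) σ).toOp) =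
        ((2⁻¹ : ℝ) : ℂ) * opTrace (M i * (Λ i σ).toOp) := by
      intro i
      rw [← ContinuousLinearMap.mul_def, LinearMap.smul_apply, TraceClass.toOp_smul,
        mul_smul_comm, opTrace_smul]
      norm_num
    have e : ∀ w : Y, ‖w‖ = 1 → (⟪w, M 1 w⟫_ℂ).re = 1 - (⟪w, M 0 w⟫_ℂ).re := by
      intro w hw
      rw [hM1, sub_apply, one_apply_eq_self, inner_sub_right, inner_self_eq_norm_sq_to_K, hw]
      simp
    simp only [successProb, Fin.sum_univ_two, hc, Complex.re_ofReal_mul]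
    change 2⁻¹ * (opTrace (M 0 * (measurePrepare φ y z σ).toOp)).re +
      2⁻¹ * (opTrace (M 1 * (measurePrepare φ z y σ).toOp)).re = _
    have hsub : (1 : ℂ) - φ σ = ((1 - (φ σ).re : ℝ) : ℂ) := by
      rw [(hreal σ hσ).1]; push_cast; simp
    rw [opTrace_mul_measurePrepare, opTrace_mul_measurePrepare, hσ.2, hsub, (hreal σ hσ).1]
    simp only [Complex.add_re, Complex.re_ofReal_mul, Complex.ofReal_re]
    rw [e y hy, e z hz]
    ring
  -- The factor 2φ(σ) - 1 is nonnegative and ⟨y, M₀ y⟩ - ⟨z, M₀ z⟩ ≤ 1, so the success probability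
  -- is at most φ(σ) ≤ s.
  have hle : ∀ σ ∈ F, optimalSuccessProb (fun i => (1 / 2 : ℂ) • Λ i) σ ≤ s := by
    intro σ hσ
    refine optimalSuccessProb_le fun M hM => ?_
    rw [hprob σ (hFD hσ) M hM]
    have h1 := (hreal σ (hFD hσ)).2
    have h2 := (Complex.nonneg_iff.1 ((hM.1 0).inner_nonneg_right z)).1
    have h3 := (Complex.nonneg_iff.1 ((hM.isPositive_one_sub 0).inner_nonneg_right y)).1
    rw [sub_apply, one_apply_eq_self, inner_sub_right, inner_self_eq_norm_sq_to_K, hy] at h3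
    simp only [Complex.coe_algebraMap, Complex.ofReal_one, one_pow, Complex.sub_re,
      Complex.one_re] at h3
    have h4 := hs σ hσ
    nlinarith
  have hge : ∀ σ ∈ densityOperators X,
      (φ σ).re ≤ optimalSuccessProb (fun i => (1 / 2 : ℂ) • Λ i) σ := by
    intro σ hσ
    -- Measuring |y⟩⟨y| makes the difference of expectations equal to 1, by orthogonality of y and
    -- z.
    have hP := InnerProductSpace.isStarProjection_rankOne_self (𝕜 := ℂ) hy
    have hM := isPOVM_pair (.of_isStarProjection hP) (.of_isStarProjection hP.one_sub)
    refine le_of_eq_of_le ?_ (hΨ.successProb_le_optimal hM hσ)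
    rw [hprob σ hσ _ hM]
    simp [hyz, hy]
  refine ⟨Λ, hΛ, ?_⟩
  obtain ⟨τ, hτ⟩ := hFne
  have hsup : sSup (optimalSuccessProb (fun i => (1 / 2 : ℂ) • Λ i) '' F) ≤ s :=
    csSup_le ⟨_, τ, hτ, rfl⟩ (by rintro _ ⟨σ, hσ, rfl⟩; exact hle σ hσ)
  -- Any free state already succeeds with probability at least 1/2.
  have hpos : 0 < sSup (optimalSuccessProb (fun i => (1 / 2 : ℂ) • Λ i) '' F) := by
    have h1 := (hreal τ (hFD hτ)).2
    have h2 := hge τ (hFD hτ)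
    have h3 : _ ≤ sSup (optimalSuccessProb (fun i => (1 / 2 : ℂ) • Λ i) '' F) :=
      le_csSup ⟨s, by rintro _ ⟨σ, hσ, rfl⟩; exact hle σ hσ⟩ ⟨τ, hτ, rfl⟩
    linarith
  rw [one_lt_div hpos]
  exact hsup.trans_lt (hsρ.trans_le (hge ρ hρ))

end Discrimination

end QResource

theorem theorem1 {X : Type*} [NormedAddCommGroup X] [InnerProductSpace ℂ X]
    [CompleteSpace X] {Y : Type*} [NormedAddCommGroup Y] [InnerProductSpace ℂ Y] [CompleteSpace Y]
    (hY : 2 ≤ Module.rank ℂ Y)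
    (F : Set (TraceClass X)) (hFD : F ⊆ densityOperators X) (hFne : F.Nonempty)
    (hFconv : Convex ℝ F) (hFclosed : IsClosed F)
    (ρ : TraceClass X) (hρ : ρ ∈ densityOperators X) :
    (∀ Ψ : Fin 2 → TraceClass X →ₗ[ℂ] TraceClass Y, IsSubchannelEnsemble Ψ →
      ∀ η ∈ densityOperators X, ∃ M : Fin 2 → Y →L[ℂ] Y, IsPOVM M ∧
        ∀ M' : Fin 2 → Y →L[ℂ] Y, IsPOVM M' → successProb Ψ M' η ≤ successProb Ψ M η) ∧
    (ρ ∉ F ↔ ∃ Ψ : Fin 2 → TraceClass X →ₗ[ℂ] TraceClass Y, IsSubchannelEnsemble Ψ ∧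
      1 < optimalSuccessProb Ψ ρ / sSup (optimalSuccessProb Ψ '' F)) ∧
    (ρ ∉ F ↔ ∃ Λ : Fin 2 → TraceClass X →ₗ[ℂ] TraceClass Y, (∀ i, IsChannel (Λ i)) ∧
      1 < optimalSuccessProb (fun i => (1 / 2 : ℂ) • Λ i) ρ /
        sSup (optimalSuccessProb (fun i => (1 / 2 : ℂ) • Λ i) '' F)) := by
  have hadv := fun hρF => exists_channels_one_lt hY hFD hFne hFconv hFclosed hρ hρF
  refine ⟨fun Ψ hΨ η hη => exists_optimal_measurement hΨ hη, ⟨fun hρF => ?_, ?_⟩, hadv, ?_⟩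
  · obtain ⟨Λ, hΛ, h⟩ := hadv hρF
    exact ⟨_, isSubchannelEnsemble_half hΛ, h⟩
  · rintro ⟨Ψ, hΨ, h⟩ hρF
    exact h.not_ge (optimalSuccessProb_div_le_one hFD hΨ hρF)
  · rintro ⟨Λ, hΛ, h⟩ hρF
    exact h.not_ge (optimalSuccessProb_div_le_one hFD (isSubchannelEnsemble_half hΛ) hρF)
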